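/- **Conventions.** In a symmetric monoidal category $\mathcal{C}$ with unit $I$, write $c_1\otimes\cdots\otimes c_k$ for the left-bracketed product $((c_1\otimes c_2)\otimes\cdots)\otimes c_k$ (it is $I$ for $k=0$ and $c_1$ for $k=1$), and $c^{\otimes m}$ for the product of $m$ copies of $c$. Let $\sigma\colon c^{\otimes m}\otimes d^{\otimes m}\to(c\otimes d)^{\otimes m}$ and $\sigma\colon I\to I^{\otimes m}$ be the canonical symmetry isomorphisms. A *prop* is a symmetric strict monoidal category $\mathbb{P}$ whose monoid of objects is $(\mathbb{N},0,+)$. A *supply* of $\mathbb{P}$ in $\mathcal{C}$ is a family of strong symmetric monoidal functors $s_c\colon\mathbb{P}\to\mathcal{C}$, one for each object $c$ of $\mathcal{C}$, such that (i) $s_c(m)=c^{\otimes m}$ for all $m$; (ii) the structure isomorphism $c^{\otimes m}\otimes c^{\otimes n}\to c^{\otimes(m+n)}$ of $s_c$ is the coherence isomorphism made of associators and unitors, for all $m,n$; and (iii) for all objects $c,d$ and all $\mu\colon m\to n$ in $\mathbb{P}$, $s_{c\otimes d}(\mu)\circ\sigma=\sigma\circ(s_c(\mu)\otimes s_d(\mu))$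 and $s_I(\mu)\circ\sigma=\sigma$. The *Mac Lane strictification* $\mathcal{C}^{\mathrm{str}}$ has as objects the finite lists $[c_1,\dots,c_k]$ of objects of $\mathcal{C}$, and as morphisms $[c_1,\dots,c_k]\to[d_1,\dots,d_l]$ the morphisms $c_1\otimes\cdots\otimes c_k\to d_1\otimes\cdots\otimes d_l$ of $\mathcal{C}$. It is a symmetric strict monoidal category under concatenation of lists, written $\cdot$, with the tensor product of morphisms and the braiding taken from $\mathcal{C}$ via the coherence isomorphisms. There is a strong symmetric monoidal, fully faithful functor $\bigotimes\colon\mathcal{C}^{\mathrm{str}}\to\mathcal{C}$, $[c_1,\dots,c_k]\mapsto c_1\otimes\cdots\otimes c_k$. **Proposition.** Let $\mathbb{P}$ be a prop, $\mathcal{C}$ a symmetric monoidal category and $s$ a supply of $\mathbb{P}$ in $\mathcal{C}$. Then $s$ induces a supply $t$ of $\mathbb{P}$ in $\mathcal{C}^{\mathrm{str}}$. Precisely, there is a supply $t$ of $\mathbb{P}$ in $\mathcal{C}^{\mathrm{str}}$ such that every functor $t_L$ is strict monoidal; for each object $c$ of $\mathcal{C}$ the functor $s_c$ factors as $\mathbb{P}\xrightarrow{\,t_{[c]}\,}\mathcal{C}^{\mathrm{str}}\xrightarrow{\,\bigotimes\,}\mathcal{C}$,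 as a strong monoidal functor; and for each list $L=[c_1,\dots,c_k]$ and each $\mu\colon m\to n$ in $\mathbb{P}$, $$t_L(\mu)=\sigma\circ\bigl(t_{[c_1]}(\mu)\cdot\ldots\cdot t_{[c_k]}(\mu)\bigr)\circ\sigma^{-1},$$ where $\sigma\colon[c_1]^{\otimes m}\cdot\ldots\cdot[c_k]^{\otimes m}\to L^{\otimes m}$ (and likewise for $n$) is the symmetry isomorphism of $\mathcal{C}^{\mathrm{str}}$. -/

import Mathlib

open CategoryTheory MonoidalCategory

noncomputable section

namespace Supplies

universe v u v₁ u₁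

/-! ### Strict monoidal categories and props -/

/-- A monoidal category is strict if tensoring is associative and unital on the nose and the
associators and unitors are identities. -/
class StrictMonoidal (C : Type u) [Category.{v} C] [MonoidalCategory C] : Prop where
  assoc : ∀ X Y Z : C, (X ⊗ Y) ⊗ Z = X ⊗ (Y ⊗ Z)
  unit_tensor : ∀ X : C, 𝟙_ C ⊗ X = X
  tensor_unit : ∀ X : C, X ⊗ 𝟙_ C = X
  associator_eq : ∀ X Y Z : C, (α_ X Y Z).hom = eqToHom (assoc X Y Z)
  leftUnitor_eq : ∀ X : C, (λ_ X).hom = eqToHom (unit_tensor X)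
  rightUnitor_eq : ∀ X : C, (ρ_ X).hom = eqToHom (tensor_unit X)

/-- A prop: a symmetric strict monoidal category whose monoid of objects is `(ℕ, 0, +)`.
`ob m` is the object named by the natural number `m`. -/
class PropCat (P : Type u₁) [Category.{v₁} P] [MonoidalCategory P] [SymmetricCategory P] extends
    StrictMonoidal P where
  ob : ℕ → P
  ob_bijective : Function.Bijective ob
  ob_zero : ob 0 = 𝟙_ P
  ob_add : ∀ m n : ℕ, ob (m + n) = ob m ⊗ ob n

/-- A strong monoidal functor is strict if its structure isomorphisms are identities. -/
def IsStrictFunctor {C : Type u} [Category.{v} C] [MonoidalCategory C]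
    {D : Type u₁} [Category.{v₁} D] [MonoidalCategory D] (F : C ⥤ D) [F.Monoidal] : Prop :=
  (∃ h : 𝟙_ D = F.obj (𝟙_ C), Functor.LaxMonoidal.ε F = eqToHom h) ∧
    ∀ X Y : C, ∃ h : F.obj X ⊗ F.obj Y = F.obj (X ⊗ Y),
      Functor.LaxMonoidal.μ F X Y = eqToHom h

/-- Two functors are equal as strong monoidal functors: equal on objects and morphisms, with the same
structure isomorphisms. -/
def SameMonoidalFunctor {C : Type u} [Category.{v} C] [MonoidalCategory C]
    {D : Type u₁} [Category.{v₁} D] [MonoidalCategory D] (F G : C ⥤ D) [F.Monoidal] [G.Monoidal] :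
    Prop :=
  F = G ∧ HEq (Functor.LaxMonoidal.ε F) (Functor.LaxMonoidal.ε G) ∧
    ∀ X Y : C, HEq (Functor.LaxMonoidal.μ F X Y) (Functor.LaxMonoidal.μ G X Y)

/-! ### Tensor powers and their canonical isomorphisms -/

section Powers

variable {C : Type u} [Category.{v} C] [MonoidalCategory C]

/-- The tensor power `((c ⊗ c) ⊗ ⋯) ⊗ c`, with `tpow c 0 = 𝟙_ C` and `tpow c 1 = c`. -/
@[reducible] def tpow (c : C) : ℕ → C
  | 0 => 𝟙_ C
  | 1 => c
  | n + 2 => tpow c (n + 1) ⊗ c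

/-- The canonical isomorphism `c^(n+1) ≅ c^n ⊗ c`; it is a unitor for `n = 0` and the identity
otherwise. -/
def tpowSucc (c : C) : ∀ n : ℕ, tpow c (n + 1) ≅ tpow c n ⊗ c
  | 0 => (λ_ c).symm
  | _ + 1 => Iso.refl _

/-- The coherence isomorphism `c^m ⊗ c^n ≅ c^(m+n)`, composed of associators and unitors. -/
def tpowAdd (c : C) (m : ℕ) : ∀ n : ℕ, tpow c m ⊗ tpow c n ≅ tpow c (m + n)
  | 0 => ρ_ _
  | n + 1 =>
      whiskerLeftIso (tpow c m) (tpowSucc c n) ≪≫ (α_ (tpow c m) (tpow c n) c).symm ≪≫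
        whiskerRightIso (tpowAdd c m n) c ≪≫ (tpowSucc c (m + n)).symm

/-- The symmetry isomorphism `I ≅ I^n`. -/
def symmUnit (C : Type u) [Category.{v} C] [MonoidalCategory C] :
    ∀ n : ℕ, 𝟙_ C ≅ tpow (𝟙_ C) n
  | 0 => Iso.refl _
  | n + 1 =>
      (λ_ (𝟙_ C)).symm ≪≫ whiskerRightIso (symmUnit C n) (𝟙_ C) ≪≫ (tpowSucc (𝟙_ C) n).symm

/-- The middle-four interchange `(a ⊗ b) ⊗ (c ⊗ d) ≅ (a ⊗ c) ⊗ (b ⊗ d)`, as an isomorphism. -/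
def interchange [SymmetricCategory C] (a b c d : C) :
    (a ⊗ b) ⊗ (c ⊗ d) ≅ (a ⊗ c) ⊗ (b ⊗ d) where
  hom := tensorμ a b c d
  inv := tensorδ a b c d
  hom_inv_id := tensorμ_tensorδ a b c d
  inv_hom_id := tensorδ_tensorμ a b c d

/-- The symmetry isomorphism `c^n ⊗ d^n ≅ (c ⊗ d)^n`, interleaving the factors. -/
def symmTensor [SymmetricCategory C] (c d : C) :
    ∀ n : ℕ, tpow c n ⊗ tpow d n ≅ tpow (c ⊗ d) n
  | 0 => λ_ (𝟙_ C)
  | n + 1 =>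
      (tpowSucc c n ⊗ᵢ tpowSucc d n) ≪≫ interchange (tpow c n) c (tpow d n) d ≪≫
        whiskerRightIso (symmTensor c d n) (c ⊗ d) ≪≫ (tpowSucc (c ⊗ d) n).symm

end Powers

/-! ### Supply -/

open PropCat in
/-- A supply of the prop `P` in the symmetric monoidal category `C`: a strong symmetric monoidal
functor `s_c : P ⥤ C` for each object `c`, with
(i) `s_c(m) = c^m`,
(ii) structure isomorphisms `c^m ⊗ c^n ⟶ c^(m+n)` the coherence isomorphisms, and
(iii) compatibility with the tensor products and the unit of `C`.
The morphisms `eqToHom _` only express the identifications of objects in (i) and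
`ob (m + n) = ob m ⊗ ob n`. -/
structure Supply (P : Type u₁) [Category.{v₁} P] [MonoidalCategory P] [SymmetricCategory P]
    [PropCat P] (C : Type u) [Category.{v} C] [MonoidalCategory C] [SymmetricCategory C] where
  functor : C → P ⥤ C
  [braided : ∀ c : C, (functor c).Braided]
  obj_eq : ∀ (c : C) (m : ℕ), (functor c).obj (ob m) = tpow c m
  mu_eq : ∀ (c : C) (m n : ℕ),
    (eqToHom (obj_eq c m).symm ⊗ₘ eqToHom (obj_eq c n).symm) ≫
        Functor.LaxMonoidal.μ (functor c) (ob m) (ob n) ≫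
        eqToHom ((congrArg (functor c).obj (ob_add m n).symm).trans (obj_eq c (m + n))) =
      (tpowAdd c m n).hom
  tensor_comm : ∀ (c d : C) (m n : ℕ) (f : (ob m : P) ⟶ ob n),
    ((eqToHom (obj_eq c m).symm ≫ (functor c).map f ≫ eqToHom (obj_eq c n)) ⊗ₘ
          (eqToHom (obj_eq d m).symm ≫ (functor d).map f ≫ eqToHom (obj_eq d n))) ≫
        (symmTensor c d n).hom =
      (symmTensor c d m).hom ≫
        (eqToHom (obj_eq (c ⊗ d) m).symm ≫ (functor (c ⊗ d)).map f ≫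
          eqToHom (obj_eq (c ⊗ d) n))
  unit_comm : ∀ (m n : ℕ) (f : (ob m : P) ⟶ ob n),
    (symmUnit C n).hom =
      (symmUnit C m).hom ≫
        (eqToHom (obj_eq (𝟙_ C) m).symm ≫ (functor (𝟙_ C)).map f ≫ eqToHom (obj_eq (𝟙_ C) n))

attribute [instance] Supply.braided

/-- The morphism `s_c(f) : c^m ⟶ c^n` for `f : m ⟶ n` in the prop. -/
def Supply.app {P : Type u₁} [Category.{v₁} P] [MonoidalCategory P] [SymmetricCategory P]
    [PropCat P] {C : Type u} [Category.{v} C] [MonoidalCategory C] [SymmetricCategory C]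
    (s : Supply P C) (c : C) {m n : ℕ} (f : (PropCat.ob m : P) ⟶ PropCat.ob n) :
    tpow c m ⟶ tpow c n :=
  eqToHom (s.obj_eq c m).symm ≫ (s.functor c).map f ≫ eqToHom (s.obj_eq c n)

/-! ### The Mac Lane strictification -/

section Lists

variable {C : Type u} [Category.{v} C] [MonoidalCategory C]

/-- `((X ⊗ c₁) ⊗ ⋯) ⊗ cₖ` for the list `[c₁, …, cₖ]`. -/
@[reducible] def tensorFrom (X : C) : List C → C
  | [] => X
  | c :: l => tensorFrom (X ⊗ c) l

/-- The left-bracketed tensor product `((c₁ ⊗ c₂) ⊗ ⋯) ⊗ cₖ` of a list, with value `𝟙_ C` on the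
empty list and `c` on `[c]`. -/
@[reducible] def bigTensor : List C → C
  | [] => 𝟙_ C
  | c :: l => tensorFrom c l

/-- `tensorFrom X l` is functorial in `X`. -/
def tensorFromIso {X Y : C} (e : X ≅ Y) : ∀ l : List C, tensorFrom X l ≅ tensorFrom Y l
  | [] => e
  | c :: l => tensorFromIso (whiskerRightIso e c) l

/-- The canonical isomorphism `X ⊗ (((Y ⊗ c₁) ⊗ ⋯) ⊗ cₖ) ≅ (((X ⊗ Y) ⊗ c₁) ⊗ ⋯) ⊗ cₖ`. -/
def tensorFromAssoc (X Y : C) : ∀ l : List C, X ⊗ tensorFrom Y l ≅ tensorFrom (X ⊗ Y) l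
  | [] => Iso.refl _
  | c :: l => tensorFromAssoc X (Y ⊗ c) l ≪≫ tensorFromIso (α_ X Y c).symm l

/-- The canonical isomorphism `X ⊗ ⨂ M ≅ ((X ⊗ c₁) ⊗ ⋯) ⊗ cₖ` for `M = [c₁, …, cₖ]`. -/
def tensorBig (X : C) : ∀ M : List C, X ⊗ bigTensor M ≅ tensorFrom X M
  | [] => ρ_ X
  | c :: l => tensorFromAssoc X c l

/-- The canonical isomorphism `(((X ⊗ c₁) ⊗ ⋯) ⊗ cₖ) ⊗ ⨂ M ≅ tensorFrom X (l ++ M)` for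
`l = [c₁, …, cₖ]`. -/
def tensorFromAppend (M : List C) : ∀ (X : C) (l : List C),
    tensorFrom X l ⊗ bigTensor M ≅ tensorFrom X (l ++ M)
  | X, [] => tensorBig X M
  | X, c :: l => tensorFromAppend M (X ⊗ c) l

/-- The canonical isomorphism `⨂ L ⊗ ⨂ M ≅ ⨂ (L ++ M)`, composed of associators and unitors. -/
def bigTensorAppend : ∀ L M : List C, bigTensor L ⊗ bigTensor M ≅ bigTensor (L ++ M)
  | [], M => λ_ (bigTensor M)
  | c :: l, M => tensorFromAppend M c l

theorem tensorFromIso_trans {X Y Z : C} (e : X ≅ Y) (f : Y ≅ Z) (l : List C) :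
    tensorFromIso (e ≪≫ f) l = tensorFromIso e l ≪≫ tensorFromIso f l := by
  induction l generalizing X Y Z with
  | nil => rfl
  | cons c l ih =>
    change tensorFromIso (whiskerRightIso (e ≪≫ f) c) l =
      tensorFromIso (whiskerRightIso e c) l ≪≫ tensorFromIso (whiskerRightIso f c) l
    rw [← ih, whiskerRightIso_trans]

theorem tensorFromIso_refl (X : C) (l : List C) :
    tensorFromIso (Iso.refl X) l = Iso.refl _ := by
  induction l generalizing X with
  | nil => rfl
  | cons c l ih =>
    simp only [tensorFromIso]
    rw [← ih]
    congr 1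
    ext
    simp

theorem tensorFromAssoc_natural_right (X : C) {Y Y' : C} (e : Y ≅ Y') (l : List C) :
    whiskerLeftIso X (tensorFromIso e l) ≪≫ tensorFromAssoc X Y' l =
      tensorFromAssoc X Y l ≪≫ tensorFromIso (whiskerLeftIso X e) l := by
  induction l generalizing Y Y' with
  | nil => ext; simp [tensorFromIso, tensorFromAssoc]
  | cons c l ih =>
    simp only [tensorFromIso, tensorFromAssoc]
    rw [← Iso.trans_assoc, ih, Iso.trans_assoc, Iso.trans_assoc, ← tensorFromIso_trans,
      ← tensorFromIso_trans]
    congr 2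
    ext; simp

theorem tensorFromAssoc_assoc (X Y Z : C) (l : List C) :
    tensorFromAssoc (X ⊗ Y) Z l ≪≫ tensorFromIso (α_ X Y Z) l =
      α_ X Y (tensorFrom Z l) ≪≫ whiskerLeftIso X (tensorFromAssoc Y Z l) ≪≫
        tensorFromAssoc X (Y ⊗ Z) l := by
  induction l generalizing Z with
  | nil => ext; simp [tensorFromIso, tensorFromAssoc]
  | cons c l ih =>
    simp only [tensorFromIso, tensorFromAssoc, whiskerLeftIso_trans, Iso.trans_assoc]
    rw [← Iso.trans_assoc (whiskerLeftIso X (tensorFromIso (α_ Y Z c).symm l)),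
      tensorFromAssoc_natural_right, Iso.trans_assoc, ← tensorFromIso_trans]
    have h : tensorFromAssoc (X ⊗ Y) (Z ⊗ c) l =
        (α_ X Y (tensorFrom (Z ⊗ c) l) ≪≫ whiskerLeftIso X (tensorFromAssoc Y (Z ⊗ c) l) ≪≫
          tensorFromAssoc X (Y ⊗ Z ⊗ c) l) ≪≫ tensorFromIso (α_ X Y (Z ⊗ c)).symm l := by
      rw [← ih, Iso.trans_assoc, ← tensorFromIso_trans, Iso.self_symm_id]
      ext
      simp [tensorFromIso_refl]
    rw [h]
    simp only [Iso.trans_assoc, ← tensorFromIso_trans]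
    congr 4
    ext
    simp

theorem tensorBig_assoc (X Y : C) (N : List C) :
    tensorBig (X ⊗ Y) N =
      α_ X Y (bigTensor N) ≪≫ whiskerLeftIso X (tensorBig Y N) ≪≫ tensorFromAssoc X Y N := by
  cases N with
  | nil => ext; simp [tensorBig, tensorFromAssoc]
  | cons e n =>
    simp only [tensorBig, tensorFromAssoc]
    rw [← Iso.trans_assoc (whiskerLeftIso _ _), ← Iso.trans_assoc, ← tensorFromAssoc_assoc,
      Iso.trans_assoc, ← tensorFromIso_trans, Iso.self_symm_id, tensorFromIso_refl]
    ext
    simp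

theorem tensorFromAssoc_natural_left {X X' : C} (e : X ≅ X') (Y : C) (l : List C) :
    whiskerRightIso e (tensorFrom Y l) ≪≫ tensorFromAssoc X' Y l =
      tensorFromAssoc X Y l ≪≫ tensorFromIso (whiskerRightIso e Y) l := by
  induction l generalizing Y with
  | nil => ext; simp [tensorFromIso, tensorFromAssoc]
  | cons c l ih =>
    simp only [tensorFromIso, tensorFromAssoc]
    rw [← Iso.trans_assoc, ih, Iso.trans_assoc, Iso.trans_assoc, ← tensorFromIso_trans,
      ← tensorFromIso_trans]
    congr 2
    ext; simp

theorem tensorFromAppend_natural {X X' : C} (e : X ≅ X') (l N : List C) :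
    whiskerRightIso (tensorFromIso e l) (bigTensor N) ≪≫ tensorFromAppend N X' l =
      tensorFromAppend N X l ≪≫ tensorFromIso e (l ++ N) := by
  induction l generalizing X X' with
  | nil =>
    cases N with
    | nil => ext; simp [tensorFromIso, tensorFromAppend, tensorBig]
    | cons c n => exact tensorFromAssoc_natural_left e c n
  | cons c l ih => exact ih (whiskerRightIso e c)

theorem tensorFromAppend_assoc (X d : C) (m N : List C) :
    whiskerRightIso (tensorFromAssoc X d m) (bigTensor N) ≪≫ tensorFromAppend N (X ⊗ d) m =
      α_ X (tensorFrom d m) (bigTensor N) ≪≫ whiskerLeftIso X (tensorFromAppend N d m) ≪≫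
        tensorFromAssoc X d (m ++ N) := by
  induction m generalizing d with
  | nil =>
    simp only [tensorFromAssoc, tensorFromAppend]
    refine Eq.trans ?_ (tensorBig_assoc X d N)
    ext
    simp
  | cons c m ih =>
    have h := tensorFromAppend_natural (α_ X d c).symm m N
    simp only [tensorFromAssoc, tensorFromAppend, whiskerRightIso_trans, Iso.trans_assoc,
      List.cons_append]
    rw [h, ← Iso.trans_assoc, ih]
    simp only [Iso.trans_assoc]

theorem tensorFromAppend_append (X : C) (l M N : List C) :
    whiskerRightIso (tensorFromAppend M X l) (bigTensor N) ≪≫ tensorFromAppend N X (l ++ M) ≪≫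
        eqToIso (congrArg (tensorFrom X) (List.append_assoc l M N)) =
      α_ (tensorFrom X l) (bigTensor M) (bigTensor N) ≪≫
        whiskerLeftIso (tensorFrom X l) (bigTensorAppend M N) ≪≫ tensorFromAppend (M ++ N) X l := by
  induction l generalizing X with
  | nil =>
    cases M with
    | nil => ext; simp [tensorFromAppend, bigTensorAppend, tensorBig]
    | cons d m =>
      refine Eq.trans ?_ (tensorFromAppend_assoc X d m N)
      ext
      simp [tensorFromAppend, tensorBig]
  | cons c l ih => exact ih (X ⊗ c)

theorem bigTensorAppend_assoc (L M N : List C) :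
    whiskerRightIso (bigTensorAppend L M) (bigTensor N) ≪≫ bigTensorAppend (L ++ M) N ≪≫
        eqToIso (congrArg bigTensor (List.append_assoc L M N)) =
      α_ (bigTensor L) (bigTensor M) (bigTensor N) ≪≫
        whiskerLeftIso (bigTensor L) (bigTensorAppend M N) ≪≫ bigTensorAppend L (M ++ N) := by
  cases L with
  | nil => ext; simp [bigTensorAppend]
  | cons c l => exact tensorFromAppend_append c l M N

theorem tensorFromAppend_nil (X : C) (l : List C) :
    tensorFromAppend [] X l ≪≫ eqToIso (congrArg (tensorFrom X) (List.append_nil l)) =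
      ρ_ (tensorFrom X l) := by
  induction l generalizing X with
  | nil => ext; simp [tensorFromAppend, tensorBig]
  | cons c l ih => exact ih (X ⊗ c)

theorem bigTensorAppend_nil (L : List C) :
    bigTensorAppend L [] ≪≫ eqToIso (congrArg bigTensor (List.append_nil L)) =
      ρ_ (bigTensor L) := by
  cases L with
  | nil => ext; simp [bigTensorAppend, unitors_equal]
  | cons c l => exact tensorFromAppend_nil c l

end Lists

section Strictification

/-- The Mac Lane strictification of `C`: objects are lists of objects of `C`, and a morphism
`L ⟶ M` is a morphism `⨂ L ⟶ ⨂ M` in `C`. -/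
abbrev Strictification (C : Type u) [Category.{v} C] [MonoidalCategory C] : Type u :=
  InducedCategory C (bigTensor : List C → C)

variable (C : Type u) [Category.{v} C] [MonoidalCategory C]

/-- The functor `⨂ : Strictification C ⥤ C`, fully faithful by construction. -/
abbrev tensorFunctor : Strictification C ⥤ C :=
  inducedFunctor (bigTensor : List C → C)

variable {C}

/-- A list, seen as an object of the strictification. -/
abbrev ofList (L : List C) : Strictification C := L

/-- The monoidal product is concatenation of lists, the unit is the empty list, and the associators
and unitors are identities. Morphisms are tensored in `C` through `⨂ L ⊗ ⨂ M ≅ ⨂ (L ++ M)`. -/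
instance : MonoidalCategoryStruct (Strictification C) where
  tensorObj L M := ofList (@HAppend.hAppend (List C) (List C) (List C) _ L M)
  tensorUnit := ofList []
  whiskerLeft L _ _ f := InducedCategory.homMk
    ((bigTensorAppend L _).inv ≫ bigTensor L ◁ f.hom ≫ (bigTensorAppend L _).hom)
  whiskerRight f M := InducedCategory.homMk
    ((bigTensorAppend _ M).inv ≫ f.hom ▷ bigTensor M ≫ (bigTensorAppend _ M).hom)
  tensorHom f g := InducedCategory.homMk
    ((bigTensorAppend _ _).inv ≫ (f.hom ⊗ₘ g.hom) ≫ (bigTensorAppend _ _).hom)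
  associator L M N := eqToIso (List.append_assoc L M N)
  leftUnitor L := eqToIso (List.nil_append L)
  rightUnitor L := eqToIso (List.append_nil L)

/-- The comparison data which make `⨂` strong monoidal. -/
def inducingData : Monoidal.InducingFunctorData (tensorFunctor C) where
  μIso L M := bigTensorAppend L M
  εIso := Iso.refl _
  associator_eq L M N := by
    have h := congrArg Iso.hom (bigTensorAppend_assoc (C := C) L M N)
    have e : (tensorFunctor C).map (α_ L M N).hom =
        eqToHom (congrArg bigTensor (List.append_assoc L M N)) :=
      eqToHom_map (tensorFunctor C) (List.append_assoc L M N)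
    rw [e]
    simp only [Iso.trans_hom, whiskerRightIso_hom, whiskerLeftIso_hom, eqToIso.hom] at h
    simp only [Iso.trans_hom, Iso.symm_hom, tensorIso_hom, Iso.refl_hom, tensorHom_id,
      id_tensorHom, Category.assoc]
    refine (Iso.eq_inv_comp
      (bigTensorAppend (@HAppend.hAppend (List C) (List C) (List C) _ L M) N)).2 ?_
    refine (Iso.eq_inv_comp (whiskerRightIso (bigTensorAppend L M) (bigTensor N))).2 ?_
    exact h
  leftUnitor_eq L := by
    have e : (tensorFunctor C).map (λ_ L).hom = 𝟙 (bigTensor L) :=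
      eqToHom_map (tensorFunctor C) (List.nil_append L)
    rw [e]
    change _ = ((λ_ (bigTensor L)).inv ≫ (𝟙 (𝟙_ C) ⊗ₘ 𝟙 (bigTensor L))) ≫ (λ_ (bigTensor L)).hom
    simp
  rightUnitor_eq L := by
    have h := congrArg Iso.hom (bigTensorAppend_nil (C := C) L)
    have e : (tensorFunctor C).map (ρ_ L).hom =
        eqToHom (congrArg bigTensor (List.append_nil L)) :=
      eqToHom_map (tensorFunctor C) (List.append_nil L)
    rw [e]
    change _ = ((bigTensorAppend L []).inv ≫ (𝟙 (bigTensor L) ⊗ₘ 𝟙 (𝟙_ C))) ≫ (ρ_ (bigTensor L)).hom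
    rw [id_tensorHom_id, Category.assoc, Category.id_comp]
    exact (Iso.eq_inv_comp (bigTensorAppend L [])).2 h

instance : MonoidalCategory (Strictification C) :=
  Monoidal.induced (tensorFunctor C) inducingData

instance : StrictMonoidal (Strictification C) where
  assoc L M N := List.append_assoc L M N
  unit_tensor L := List.nil_append L
  tensor_unit L := List.append_nil L
  associator_eq _ _ _ := rfl
  leftUnitor_eq _ := rfl
  rightUnitor_eq _ := rfl

/-- `⨂ : Strictification C ⥤ C` is strong monoidal. -/
instance : (tensorFunctor C).Monoidal :=
  (Monoidal.fromInducedCoreMonoidal (tensorFunctor C) inducingData).toMonoidal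

variable [SymmetricCategory C]

/-- The braiding of lists: the braiding of `C` conjugated by `⨂ L ⊗ ⨂ M ≅ ⨂ (L ++ M)`. -/
def strictBraiding (L M : Strictification C) : L ⊗ M ≅ M ⊗ L :=
  InducedCategory.isoMk
    ((bigTensorAppend L M).symm ≪≫ β_ (bigTensor L) (bigTensor M) ≪≫ bigTensorAppend M L)

instance : BraidedCategory (Strictification C) :=
  BraidedCategory.ofFaithful (tensorFunctor C) strictBraiding (fun L M =>
    Iso.hom_inv_id_assoc (bigTensorAppend L M) _)

/-- `⨂ : Strictification C ⥤ C` is symmetric monoidal. -/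
instance : (tensorFunctor C).Braided where
  braided L M := Iso.hom_inv_id_assoc (bigTensorAppend L M) _

instance : SymmetricCategory (Strictification C) :=
  SymmetricCategory.ofFaithful (tensorFunctor C)

/-! ### Pieces of the induced supply -/

/-- The object `[c₁,…,c₁] · ⋯ · [cₖ,…,cₖ]` of the strictification, each `cᵢ` repeated `m` times. -/
def blocks (m : ℕ) : List C → Strictification C
  | [] => 𝟙_ (Strictification C)
  | c :: l => tpow (ofList [c]) m ⊗ blocks m l

/-- The morphism `g c₁ · ⋯ · g cₖ` between such objects. -/
def blocksMap {m n : ℕ} (g : ∀ c : C, tpow (ofList [c]) m ⟶ tpow (ofList [c]) n) :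
    ∀ L : List C, blocks m L ⟶ blocks n L
  | [] => 𝟙 _
  | c :: l => g c ⊗ₘ blocksMap g l

/-- The symmetry isomorphism
`[c₁,…,c₁] · ⋯ · [cₖ,…,cₖ] ≅ [c₁,…,cₖ] · ⋯ · [c₁,…,cₖ]` (with `m` factors on the right). -/
def blocksSymm (m : ℕ) : ∀ L : List C, blocks m L ≅ tpow (ofList L) m
  | [] => symmUnit (Strictification C) m
  | c :: l =>
      whiskerLeftIso (tpow (ofList [c]) m) (blocksSymm m l) ≪≫
        symmTensor (ofList [c]) (ofList l) m

end Strictification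

end Supplies

end

/-!
Call a morphism `e : c ⟶ d` of `C` homomorphic if `e^n ∘ s_c(f) = s_d(f) ∘ e^m` for all
`f : m ⟶ n` of the prop. Condition (iii) says that `c ↦ s_c(f)` is a monoidal, though not
necessarily natural, family of morphisms between the monoidal functors `c ↦ c^m` and `c ↦ c^n`.
Every such family is natural with respect to the coherence isomorphisms, so associators, unitors,
and hence `⨂ L ⊗ ⨂ M ≅ ⨂ (L ++ M)` are homomorphic.

This is exactly what is needed to pull the supply back along the fully faithful functor `⨂`: the
functor `t_L` is the lift of `s_{⨂ L}` for which the comparison `(⨂ L)^m ≅ ⨂ (L^m)` is natural,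
and homomorphy of the structure morphisms of `⨂` gives (iii). On a singleton `[c]` the comparison
is an identity, so `t_[c]` lies strictly over `s_c`. Any supply in a strict category consists of
strict functors, and the formula for `t_L` in terms of the `t_[cᵢ]` follows from (iii) by induction.
-/

noncomputable section

namespace Supplies

universe v u v₁ u₁ v₂ u₂

open Functor.LaxMonoidal

/-! ### Tensor powers as monoidal functors -/

section PowerFunctors

section

variable {C : Type u} [Category.{v} C] [MonoidalCategory C]

/-- The tensor power `f ⊗ ⋯ ⊗ f : c^n ⟶ d^n` of a morphism. -/
def tpowMap {c d : C} (f : c ⟶ d) : ∀ n : ℕ, tpow c n ⟶ tpow d n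
  | 0 => 𝟙 _
  | n + 1 => (tpowSucc c n).hom ≫ (tpowMap f n ⊗ₘ f) ≫ (tpowSucc d n).inv

theorem tpowMap_succ {c d : C} (f : c ⟶ d) (n : ℕ) :
    tpowMap f (n + 1) = (tpowSucc c n).hom ≫ (tpowMap f n ⊗ₘ f) ≫ (tpowSucc d n).inv :=
  rfl

theorem tpowMap_id (c : C) (n : ℕ) : tpowMap (𝟙 c) n = 𝟙 _ := by
  induction n with
  | zero => rfl
  | succ n ih => simp [tpowMap_succ, ih]

theorem tpowMap_comp {c d e : C} (f : c ⟶ d) (g : d ⟶ e) (n : ℕ) :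
    tpowMap (f ≫ g) n = tpowMap f n ≫ tpowMap g n := by
  induction n with
  | zero => simp [tpowMap]
  | succ n ih => simp [tpowMap_succ, ih]

theorem symmUnit_succ_hom (n : ℕ) :
    (symmUnit C (n + 1)).hom =
      (λ_ (𝟙_ C)).inv ≫ ((symmUnit C n).hom ⊗ₘ 𝟙 (𝟙_ C)) ≫ (tpowSucc (𝟙_ C) n).inv := by
  rw [tensorHom_id]; rfl

theorem symmTensor_succ_hom [SymmetricCategory C] (c d : C) (n : ℕ) :
    (symmTensor c d (n + 1)).hom =
      ((tpowSucc c n).hom ⊗ₘ (tpowSucc d n).hom) ≫ tensorμ (tpow c n) c (tpow d n) d ≫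
        ((symmTensor c d n).hom ⊗ₘ 𝟙 (c ⊗ d)) ≫ (tpowSucc (c ⊗ d) n).inv := by
  rw [tensorHom_id]; rfl

end

variable (C : Type u) [Category.{v} C] [MonoidalCategory C]

/-- The `n`-th tensor power, as an endofunctor. -/
@[simps]
def tpowFunctor (n : ℕ) : C ⥤ C where
  obj c := tpow c n
  map f := tpowMap f n
  map_id c := tpowMap_id c n
  map_comp f g := tpowMap_comp f g n

/-- The isomorphism `c^n ⊗ c ≅ c^(n+1)`, natural in `c`. -/
def tpowFunctorSucc (n : ℕ) :
    (tpowFunctor C n).prod' (𝟭 C) ⋙ tensor C ≅ tpowFunctor C (n + 1) :=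
  NatIso.ofComponents (fun c => (tpowSucc c n).symm) fun {c d} f =>
    (Iso.inv_hom_id_assoc (tpowSucc c n) ((tpowMap f n ⊗ₘ f) ≫ (tpowSucc d n).inv)).symm

theorem tpowFunctorSucc_hom_app (n : ℕ) (c : C) :
    (tpowFunctorSucc C n).hom.app c = (tpowSucc c n).inv :=
  rfl

/-- The zeroth tensor power is the constant functor at the unit, which is monoidal. -/
def tpowFunctorZeroCoreMonoidal : (tpowFunctor C 0).CoreMonoidal where
  εIso := Iso.refl (𝟙_ C)
  μIso _ _ := λ_ (𝟙_ C)
  μIso_hom_natural_left _ _ := by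
    change 𝟙 (𝟙_ C) ▷ 𝟙_ C ≫ _ = _ ≫ 𝟙 (𝟙_ C)
    simp
  μIso_hom_natural_right _ _ := by
    change 𝟙_ C ◁ 𝟙 (𝟙_ C) ≫ _ = _ ≫ 𝟙 (𝟙_ C)
    simp
  associativity _ _ _ := by
    change (λ_ (𝟙_ C)).hom ▷ 𝟙_ C ≫ (λ_ (𝟙_ C)).hom ≫ 𝟙 (𝟙_ C) =
      (α_ (𝟙_ C) (𝟙_ C) (𝟙_ C)).hom ≫ 𝟙_ C ◁ (λ_ (𝟙_ C)).hom ≫ (λ_ (𝟙_ C)).hom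
    monoidal
  left_unitality _ := by
    change (λ_ (𝟙_ C)).hom = 𝟙 (𝟙_ C) ▷ 𝟙_ C ≫ (λ_ (𝟙_ C)).hom ≫ 𝟙 (𝟙_ C)
    simp
  right_unitality _ := by
    change (ρ_ (𝟙_ C)).hom = 𝟙_ C ◁ 𝟙 (𝟙_ C) ≫ (λ_ (𝟙_ C)).hom ≫ 𝟙 (𝟙_ C)
    simp [unitors_equal]

variable [SymmetricCategory C]

/-- Tensor powers are strong monoidal functors; the structure isomorphisms are the symmetry
isomorphisms `I ≅ I^n` and `c^n ⊗ d^n ≅ (c ⊗ d)^n`. -/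
instance tpowFunctorMonoidal : ∀ n : ℕ, (tpowFunctor C n).Monoidal
  | 0 => (tpowFunctorZeroCoreMonoidal C).toMonoidal
  | n + 1 =>
    letI := tpowFunctorMonoidal n
    Functor.Monoidal.transport (tpowFunctorSucc C n)

variable {C}

theorem ε_tpowFunctor (n : ℕ) : ε (tpowFunctor C n) = (symmUnit C n).hom := by
  induction n with
  | zero => rfl
  | succ n ih =>
    have ε_prod : ε ((tpowFunctor C n).prod' (𝟭 C) ⋙ tensor C) =
        (λ_ (𝟙_ C)).inv ≫ ((symmUnit C n).hom ⊗ₘ 𝟙 (𝟙_ C)) := by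
      simp only [comp_ε, tensor_ε, tensor_map, Functor.prod'_ε_fst, Functor.prod'_ε_snd, id_ε, ih]
      rfl
    refine (Functor.Monoidal.transport_ε (tpowFunctorSucc C n)).trans ?_
    rw [ε_prod, symmUnit_succ_hom, tpowFunctorSucc_hom_app]
    exact Category.assoc _ _ _

theorem μ_tpowFunctor (c d : C) (n : ℕ) :
    μ (tpowFunctor C n) c d = (symmTensor c d n).hom := by
  induction n with
  | zero => rfl
  | succ n ih =>
    have μ_prod : μ ((tpowFunctor C n).prod' (𝟭 C) ⋙ tensor C) c d =
        tensorμ (tpow c n) c (tpow d n) d ≫ ((symmTensor c d n).hom ⊗ₘ 𝟙 (c ⊗ d)) := by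
      simp only [comp_μ, tensor_μ, tensor_map, Functor.prod'_μ_fst, Functor.prod'_μ_snd, id_μ, ih]
      rfl
    refine (Functor.Monoidal.transport_μ (tpowFunctorSucc C n) c d).trans ?_
    rw [μ_prod, symmTensor_succ_hom, tpowFunctorSucc_hom_app]
    exact congrArg (_ ≫ ·) (Category.assoc _ _ _)

end PowerFunctors

/-! ### Monoidal functors and tensor powers -/

section Comparison

variable {C : Type u} [Category.{v} C] [MonoidalCategory C]
  {D : Type u₁} [Category.{v₁} D] [MonoidalCategory D] (F : D ⥤ C)

section

variable [F.Monoidal]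

/-- The comparison isomorphism `(F d)^n ≅ F (d^n)` of a strong monoidal functor. -/
def tpowComparison (d : D) : ∀ n : ℕ, tpow (F.obj d) n ≅ F.obj (tpow d n)
  | 0 => Functor.Monoidal.εIso F
  | n + 1 =>
      tpowSucc (F.obj d) n ≪≫ (tpowComparison d n ⊗ᵢ Iso.refl (F.obj d)) ≪≫
        Functor.Monoidal.μIso F (tpow d n) d ≪≫ F.mapIso (tpowSucc d n).symm

theorem tpowComparison_zero_hom (d : D) : (tpowComparison F d 0).hom = ε F :=
  rfl

theorem tpowComparison_succ_hom (d : D) (n : ℕ) :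
    (tpowComparison F d (n + 1)).hom =
      (tpowSucc (F.obj d) n).hom ≫ ((tpowComparison F d n).hom ⊗ₘ 𝟙 (F.obj d)) ≫
        μ F (tpow d n) d ≫ F.map (tpowSucc d n).inv :=
  rfl

theorem tpowAdd_zero_hom (c : C) (m : ℕ) : (tpowAdd c m 0).hom = (ρ_ (tpow c m)).hom :=
  rfl

theorem tpowAdd_succ_hom (c : C) (m n : ℕ) :
    (tpowAdd c m (n + 1)).hom =
      tpow c m ◁ (tpowSucc c n).hom ≫ (α_ (tpow c m) (tpow c n) c).inv ≫
        (tpowAdd c m n).hom ▷ c ≫ (tpowSucc c (m + n)).inv :=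
  rfl

theorem tpowComparison_tpowAdd (d : D) (m n : ℕ) :
    ((tpowComparison F d m).hom ⊗ₘ (tpowComparison F d n).hom) ≫ μ F (tpow d m) (tpow d n) ≫
        F.map (tpowAdd d m n).hom =
      (tpowAdd (F.obj d) m n).hom ≫ (tpowComparison F d (m + n)).hom := by
  induction n with
  | zero =>
    rw [tpowAdd_zero_hom, tpowAdd_zero_hom, tpowComparison_zero_hom,
      MonoidalCategory.tensorHom_def, Category.assoc, ← right_unitality F (tpow d m)]
    exact rightUnitor_naturality (tpowComparison F d m).hom
  | succ n ih =>
    have split : ((tpowComparison F d m).hom ⊗ₘ (tpowComparison F d (n + 1)).hom) =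
        tpow (F.obj d) m ◁ (tpowSucc (F.obj d) n).hom ≫
          ((tpowComparison F d m).hom ⊗ₘ ((tpowComparison F d n).hom ⊗ₘ 𝟙 (F.obj d))) ≫
            F.obj (tpow d m) ◁ μ F (tpow d n) d ≫
              F.obj (tpow d m) ◁ F.map (tpowSucc d n).inv := by
      simp only [tpowComparison_succ_hom, ← id_tensorHom, tensorHom_comp_tensorHom,
        Category.comp_id, Category.id_comp]
    have step : (tpowComparison F d (m + (n + 1))).hom =
        (tpowSucc (F.obj d) (m + n)).hom ≫ (tpowComparison F d (m + n)).hom ▷ F.obj d ≫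
          μ F (tpow d (m + n)) d ≫ F.map (tpowSucc d (m + n)).inv := by
      rw [← tensorHom_id]; rfl
    have ih_whiskered := congrArg (· ▷ F.obj d) ih
    simp only [comp_whiskerRight] at ih_whiskered
    rw [split, step, tpowAdd_succ_hom, tpowAdd_succ_hom]
    simp only [Category.assoc, Iso.inv_hom_id_assoc]
    rw [← reassoc_of% ih_whiskered]
    simp only [Functor.map_comp, μ_natural_left_assoc, μ_natural_right_assoc]
    rw [← F.map_comp_assoc (tpow d m ◁ _), ← MonoidalCategory.whiskerLeft_comp, Iso.inv_hom_id,
      MonoidalCategory.whiskerLeft_id, F.map_id, Category.id_comp, associativity_inv_assoc,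
      ← tensorHom_id (_ ⊗ₘ _), ← associator_inv_naturality_assoc]

theorem ε_comp_map_symmUnit (n : ℕ) :
    ε F ≫ F.map (symmUnit D n).hom =
      (symmUnit C n).hom ≫ tpowMap (ε F) n ≫ (tpowComparison F (𝟙_ D) n).hom := by
  induction n with
  | zero => simp [symmUnit, tpowMap, tpowComparison_zero_hom]
  | succ n ih =>
    have ih_tensored : ((symmUnit C n).hom ⊗ₘ 𝟙 (𝟙_ C)) ≫ (tpowMap (ε F) n ⊗ₘ ε F) ≫
        ((tpowComparison F (𝟙_ D) n).hom ⊗ₘ 𝟙 (F.obj (𝟙_ D))) =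
        𝟙_ C ◁ ε F ≫ ε F ▷ F.obj (𝟙_ D) ≫ F.map (symmUnit D n).hom ▷ F.obj (𝟙_ D) := by
      simp only [← id_tensorHom, ← tensorHom_id, tensorHom_comp_tensorHom, Category.comp_id,
        Category.id_comp, ih]
    rw [symmUnit_succ_hom, symmUnit_succ_hom, tpowMap_succ, tpowComparison_succ_hom,
      tensorHom_id (symmUnit D n).hom]
    simp only [Category.assoc, Iso.inv_hom_id_assoc, Functor.map_comp]
    rw [reassoc_of% ih_tensored, μ_natural_left_assoc, ← leftUnitor_inv_naturality_assoc,
      ← left_unitality_inv_assoc]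

end

variable [SymmetricCategory C] [SymmetricCategory D] [F.Braided]

theorem tpowComparison_symmTensor (c d : D) (n : ℕ) :
    ((tpowComparison F c n).hom ⊗ₘ (tpowComparison F d n).hom) ≫ μ F (tpow c n) (tpow d n) ≫
        F.map (symmTensor c d n).hom =
      (symmTensor (F.obj c) (F.obj d) n).hom ≫ tpowMap (μ F c d) n ≫
        (tpowComparison F (c ⊗ d) n).hom := by
  induction n with
  | zero =>
    change (ε F ⊗ₘ ε F) ≫ μ F (𝟙_ D) (𝟙_ D) ≫ F.map (λ_ (𝟙_ D)).hom =
      (λ_ (𝟙_ C)).hom ≫ 𝟙 _ ≫ ε F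
    rw [tensorHom_def', Category.assoc, ← left_unitality F (𝟙_ D), Category.id_comp,
      leftUnitor_naturality]
  | succ n ih =>
    have split : ((tpowComparison F c (n + 1)).hom ⊗ₘ (tpowComparison F d (n + 1)).hom) =
        ((tpowSucc (F.obj c) n).hom ⊗ₘ (tpowSucc (F.obj d) n).hom) ≫
          (((tpowComparison F c n).hom ⊗ₘ 𝟙 (F.obj c)) ⊗ₘ
            ((tpowComparison F d n).hom ⊗ₘ 𝟙 (F.obj d))) ≫
          (μ F (tpow c n) c ⊗ₘ μ F (tpow d n) d) ≫
          (F.map (tpowSucc c n).inv ⊗ₘ F.map (tpowSucc d n).inv) := by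
      simp only [tpowComparison_succ_hom, tensorHom_comp_tensorHom]
    have ih_tensored :
        (((tpowComparison F c n).hom ⊗ₘ (tpowComparison F d n).hom) ⊗ₘ 𝟙 (F.obj c ⊗ F.obj d)) ≫
          (μ F (tpow c n) (tpow d n) ⊗ₘ μ F c d) ≫
            (F.map (symmTensor c d n).hom ⊗ₘ 𝟙 (F.obj (c ⊗ d))) =
        ((symmTensor (F.obj c) (F.obj d) n).hom ⊗ₘ 𝟙 (F.obj c ⊗ F.obj d)) ≫
          (tpowMap (μ F c d) n ⊗ₘ μ F c d) ≫
            ((tpowComparison F (c ⊗ d) n).hom ⊗ₘ 𝟙 (F.obj (c ⊗ d))) := by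
      simp only [tensorHom_comp_tensorHom, Category.comp_id, Category.id_comp, ih]
    rw [split, symmTensor_succ_hom, symmTensor_succ_hom, tpowMap_succ, tpowComparison_succ_hom]
    simp only [Category.assoc, Iso.inv_hom_id_assoc, Functor.map_comp, μ_natural_assoc]
    rw [← F.map_comp_assoc, tensorHom_comp_tensorHom, Iso.inv_hom_id, Iso.inv_hom_id,
      id_tensorHom_id, F.map_id, Category.id_comp,
      ← tensorμ_comp_μ_tensorHom_μ_comp_μ_assoc, tensorμ_natural_assoc, id_tensorHom_id,
      ← reassoc_of% ih_tensored, ← F.map_id, ← μ_natural_assoc]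

end Comparison

/-! ### Coherence isomorphisms and monoidal families -/

section MonoidalFamilies

variable {C : Type u} [Category.{v} C] [MonoidalCategory C]
  {D : Type u₁} [Category.{v₁} D] [MonoidalCategory D] {F G : C ⥤ D}

/-- A family of morphisms `F c ⟶ G c`, not necessarily natural in `c`, that is compatible with the
structure morphisms of the monoidal functors `F` and `G`. -/
structure IsMonoidalFamily [F.LaxMonoidal] [G.LaxMonoidal] (φ : ∀ c, F.obj c ⟶ G.obj c) :
    Prop where
  unit : ε F ≫ φ (𝟙_ C) = ε G
  tensor (c d : C) : μ F c d ≫ φ (c ⊗ d) = (φ c ⊗ₘ φ d) ≫ μ G c d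

namespace IsMonoidalFamily

open MorphismProperty

variable [F.Monoidal] [G.LaxMonoidal] {φ : ∀ c, F.obj c ⟶ G.obj c}

theorem naturalityProperty_isMonoidal (hφ : IsMonoidalFamily φ) :
    (naturalityProperty φ).IsMonoidal :=
  .mk' _ fun {a a' b b'} f g hf hg => by
    simp only [naturalityProperty] at hf hg ⊢
    rw [← cancel_epi (μ F a b), ← μ_natural_assoc, hφ.tensor, tensorHom_comp_tensorHom_assoc,
      hf, hg, ← tensorHom_comp_tensorHom_assoc, μ_natural, ← reassoc_of% (hφ.tensor a b)]

theorem naturalityProperty_leftUnitor (hφ : IsMonoidalFamily φ) (c : C) :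
    naturalityProperty φ (λ_ c).hom := by
  simp only [naturalityProperty]
  rw [← cancel_epi (μ F (𝟙_ C) c), ← cancel_epi (ε F ▷ F.obj c),
    ← left_unitality_assoc, reassoc_of% (hφ.tensor (𝟙_ C) c), ← tensorHom_id,
    tensorHom_comp_tensorHom_assoc, hφ.unit, Category.id_comp, tensorHom_def', Category.assoc,
    ← left_unitality, leftUnitor_naturality]

theorem naturalityProperty_rightUnitor (hφ : IsMonoidalFamily φ) (c : C) :
    naturalityProperty φ (ρ_ c).hom := by
  simp only [naturalityProperty]
  rw [← cancel_epi (μ F c (𝟙_ C)), ← cancel_epi (F.obj c ◁ ε F),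
    ← right_unitality_assoc, reassoc_of% (hφ.tensor c (𝟙_ C)), ← id_tensorHom,
    tensorHom_comp_tensorHom_assoc, hφ.unit, Category.id_comp,
    MonoidalCategory.tensorHom_def, Category.assoc,
    ← right_unitality, rightUnitor_naturality]

theorem naturalityProperty_associator (hφ : IsMonoidalFamily φ) (a b c : C) :
    naturalityProperty φ (α_ a b c).hom := by
  simp only [naturalityProperty]
  rw [← cancel_epi (μ F (a ⊗ b) c), ← cancel_epi (μ F a b ▷ F.obj c)]
  calc μ F a b ▷ F.obj c ≫ μ F (a ⊗ b) c ≫ F.map (α_ a b c).hom ≫ φ (a ⊗ b ⊗ c)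
    _ = (α_ _ _ _).hom ≫ (φ a ⊗ₘ (φ b ⊗ₘ φ c)) ≫ G.obj a ◁ μ G b c ≫ μ G a (b ⊗ c) := by
      rw [associativity_assoc, hφ.tensor, ← id_tensorHom, ← id_tensorHom,
        tensorHom_comp_tensorHom_assoc, tensorHom_comp_tensorHom_assoc, hφ.tensor,
        Category.id_comp, Category.comp_id]
    _ = ((φ a ⊗ₘ φ b) ⊗ₘ φ c) ≫ μ G a b ▷ G.obj c ≫ μ G (a ⊗ b) c ≫ G.map (α_ a b c).hom := by
      rw [associativity, associator_naturality_assoc]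
    _ = _ := by
      rw [reassoc_of% (hφ.tensor (a ⊗ b) c), ← tensorHom_id, ← tensorHom_id,
        tensorHom_comp_tensorHom_assoc, tensorHom_comp_tensorHom_assoc, hφ.tensor,
        Category.id_comp, Category.comp_id]

end IsMonoidalFamily

end MonoidalFamilies

section CoherenceIsomorphisms

variable {C : Type u} [Category.{v} C] [MonoidalCategory C] {W : MorphismProperty C}
  [W.IsMonoidal]

theorem tensorFromIso_hom_mem {X Y : C} {e : X ≅ Y} (he : W e.hom) (l : List C) :
    W (tensorFromIso e l).hom := by
  induction l generalizing X Y with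
  | nil => exact he
  | cons c _ ih => exact ih (W.whiskerRight_mem e.hom he c)

theorem tensorFromAssoc_hom_mem (hα : ∀ a b c : C, W (α_ a b c).inv) (X Y : C) (l : List C) :
    W (tensorFromAssoc X Y l).hom := by
  induction l generalizing Y with
  | nil => exact W.id_mem _
  | cons c l ih => exact W.comp_mem _ _ (ih (Y ⊗ c)) (tensorFromIso_hom_mem (hα X Y c) l)

theorem tensorFromAppend_hom_mem (hα : ∀ a b c : C, W (α_ a b c).inv)
    (hρ : ∀ c : C, W (ρ_ c).hom) (M : List C) (X : C) (l : List C) :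
    W (tensorFromAppend M X l).hom := by
  induction l generalizing X with
  | nil =>
    cases M with
    | nil => exact hρ X
    | cons c M => exact tensorFromAssoc_hom_mem hα X c M
  | cons c _ ih => exact ih (X ⊗ c)

theorem bigTensorAppend_hom_mem (hα : ∀ a b c : C, W (α_ a b c).inv)
    (hl : ∀ c : C, W (λ_ c).hom) (hρ : ∀ c : C, W (ρ_ c).hom) (L M : List C) :
    W (bigTensorAppend L M).hom := by
  cases L with
  | nil => exact hl (bigTensor M)
  | cons c l => exact tensorFromAppend_hom_mem hα hρ M c l

end CoherenceIsomorphisms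

theorem IsMonoidalFamily.naturalityProperty_bigTensorAppend {C : Type u} [Category.{v} C]
    [MonoidalCategory C] {D : Type u₁} [Category.{v₁} D] [MonoidalCategory D] {F G : C ⥤ D}
    [F.Monoidal] [G.LaxMonoidal] {φ : ∀ c, F.obj c ⟶ G.obj c} (hφ : IsMonoidalFamily φ)
    (L M : List C) : MorphismProperty.naturalityProperty φ (bigTensorAppend L M).hom :=
  haveI := hφ.naturalityProperty_isMonoidal
  bigTensorAppend_hom_mem
    (fun a b c => MorphismProperty.naturalityProperty.stableUnderInverse φ (α_ a b c)
      (hφ.naturalityProperty_associator a b c))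
    hφ.naturalityProperty_leftUnitor hφ.naturalityProperty_rightUnitor L M

namespace PropCat

variable {P : Type u₁} [Category.{v₁} P] [MonoidalCategory P] [SymmetricCategory P] [PropCat P]

/-- The natural number naming an object of a prop. -/
def index (X : P) : ℕ :=
  (Equiv.ofBijective ob ob_bijective).symm X

theorem ob_index (X : P) : ob (index X) = X :=
  (Equiv.ofBijective ob ob_bijective).apply_symm_apply X

theorem index_ob (m : ℕ) : index (ob m : P) = m :=
  (Equiv.ofBijective (ob : ℕ → P) ob_bijective).symm_apply_apply m

end PropCat

namespace Supply

open PropCat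

variable {P : Type u₁} [Category.{v₁} P] [MonoidalCategory P] [SymmetricCategory P] [PropCat P]
  {C : Type u} [Category.{v} C] [MonoidalCategory C] [SymmetricCategory C] (s : Supply P C)

theorem app_symmTensor (c d : C) {m n : ℕ} (f : (ob m : P) ⟶ ob n) :
    (symmTensor c d m).hom ≫ s.app (c ⊗ d) f =
      (s.app c f ⊗ₘ s.app d f) ≫ (symmTensor c d n).hom :=
  (s.tensor_comm c d m n f).symm

theorem app_symmUnit {m n : ℕ} (f : (ob m : P) ⟶ ob n) :
    (symmUnit C m).hom ≫ s.app (𝟙_ C) f = (symmUnit C n).hom :=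
  (s.unit_comm m n f).symm

theorem isMonoidalFamily_app {m n : ℕ} (f : (ob m : P) ⟶ ob n) :
    IsMonoidalFamily (F := tpowFunctor C m) (G := tpowFunctor C n) fun c => s.app c f where
  unit := by
    rw [ε_tpowFunctor, ε_tpowFunctor]
    exact s.app_symmUnit f
  tensor c d := by
    rw [μ_tpowFunctor, μ_tpowFunctor]
    exact s.app_symmTensor c d f

/-- A morphism `e` of `C` is homomorphic if all morphisms `s_c(f)` of the supply are natural along
its tensor powers. -/
def IsHomomorphic {c d : C} (e : c ⟶ d) : Prop :=
  ∀ ⦃m n : ℕ⦄ (f : (ob m : P) ⟶ ob n), tpowMap e m ≫ s.app d f = s.app c f ≫ tpowMap e n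

theorem isHomomorphic_id (c : C) : s.IsHomomorphic (𝟙 c) := fun m n f => by
  rw [tpowMap_id, tpowMap_id, Category.id_comp, Category.comp_id]

theorem isHomomorphic_bigTensorAppend (L M : List C) :
    s.IsHomomorphic (bigTensorAppend L M).hom :=
  fun _ _ f => (s.isMonoidalFamily_app f).naturalityProperty_bigTensorAppend L M

end Supply

/-! ### Lifting along fully faithful monoidal functors -/

section FunctorLift

variable {P : Type u₁} [Category.{v₁} P] {C : Type u} [Category.{v} C]
  {D : Type u₂} [Category.{v₂} D]

/-- A lift of `G` along `F`: a functor `T` with a natural isomorphism `G ≅ T ⋙ F`, given by its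
components. -/
structure FunctorLift (G : P ⥤ C) (F : D ⥤ C) where
  functor : P ⥤ D
  iso (X : P) : G.obj X ≅ F.obj (functor.obj X)
  naturality {X Y : P} (f : X ⟶ Y) :
    G.map f ≫ (iso Y).hom = (iso X).hom ≫ F.map (functor.map f)

namespace FunctorLift

variable {G : P ⥤ C} {F : D ⥤ C}

/-- The lift along a fully faithful functor with prescribed values on objects. -/
def ofIso [F.Full] [F.Faithful] (obj : P → D) (e : ∀ X, G.obj X ≅ F.obj (obj X)) :
    FunctorLift G F where
  functor :=
    { obj := obj
      map := fun {X Y} f => F.preimage ((e X).inv ≫ G.map f ≫ (e Y).hom)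
      map_id := fun X => F.map_injective (by simp)
      map_comp := fun f g => F.map_injective (by simp) }
  iso := e
  naturality f := by simp

/-- The natural isomorphism `G ≅ T ⋙ F` of a lift `T`. -/
def natIso (T : FunctorLift G F) : G ≅ T.functor ⋙ F :=
  NatIso.ofComponents T.iso T.naturality

variable [F.Full] [F.Faithful] [MonoidalCategory P] [MonoidalCategory C] [MonoidalCategory D]

section Monoidal

variable [G.Monoidal] [F.Monoidal] (T : FunctorLift G F)

/-- The unit isomorphism of a lift of a monoidal functor. -/
def εIso : 𝟙_ D ≅ T.functor.obj (𝟙_ P) :=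
  F.preimageIso ((Functor.Monoidal.εIso F).symm ≪≫ Functor.Monoidal.εIso G ≪≫ T.iso (𝟙_ P))

/-- The tensor isomorphisms of a lift of a monoidal functor. -/
def μIso (X Y : P) : T.functor.obj X ⊗ T.functor.obj Y ≅ T.functor.obj (X ⊗ Y) :=
  F.preimageIso ((Functor.Monoidal.μIso F _ _).symm ≪≫ (T.iso X ⊗ᵢ T.iso Y).symm ≪≫
    Functor.Monoidal.μIso G X Y ≪≫ T.iso (X ⊗ Y))

theorem ε_comp_map_εIso : ε F ≫ F.map T.εIso.hom = ε G ≫ (T.iso (𝟙_ P)).hom := by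
  simp [εIso]

theorem iso_tensor_comp_μ_comp_map_μIso (X Y : P) :
    ((T.iso X).hom ⊗ₘ (T.iso Y).hom) ≫ μ F _ _ ≫ F.map (T.μIso X Y).hom =
      μ G X Y ≫ (T.iso (X ⊗ Y)).hom := by
  simp [μIso, tensorHom_comp_tensorHom_assoc]

theorem μIso_natural {X X' Y Y' : P} (f : X ⟶ X') (g : Y ⟶ Y') :
    (T.functor.map f ⊗ₘ T.functor.map g) ≫ (T.μIso X' Y').hom =
      (T.μIso X Y).hom ≫ T.functor.map (f ⊗ₘ g) := by
  apply F.map_injective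
  rw [← cancel_epi (μ F _ _), ← cancel_epi ((T.iso X).hom ⊗ₘ (T.iso Y).hom),
    F.map_comp, F.map_comp, reassoc_of% (T.iso_tensor_comp_μ_comp_map_μIso X Y), ← T.naturality,
    ← μ_natural_assoc, ← μ_natural_assoc, ← T.iso_tensor_comp_μ_comp_map_μIso,
    tensorHom_comp_tensorHom_assoc, tensorHom_comp_tensorHom_assoc, T.naturality, T.naturality]

theorem μIso_associativity (X Y Z : P) :
    (T.μIso X Y).hom ▷ T.functor.obj Z ≫ (T.μIso (X ⊗ Y) Z).hom ≫
        T.functor.map (α_ X Y Z).hom =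
      (α_ _ _ _).hom ≫ T.functor.obj X ◁ (T.μIso Y Z).hom ≫ (T.μIso X (Y ⊗ Z)).hom := by
  have left : (((T.iso X).hom ⊗ₘ (T.iso Y).hom) ⊗ₘ (T.iso Z).hom) ≫
      μ F _ _ ▷ _ ≫ F.map (T.μIso X Y).hom ▷ _ =
      μ G X Y ▷ G.obj Z ≫ ((T.iso (X ⊗ Y)).hom ⊗ₘ (T.iso Z).hom) := by
    simp only [← tensorHom_id, tensorHom_comp_tensorHom, Category.comp_id, Category.id_comp,
      iso_tensor_comp_μ_comp_map_μIso]
  have right : ((T.iso X).hom ⊗ₘ ((T.iso Y).hom ⊗ₘ (T.iso Z).hom)) ≫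
      _ ◁ μ F _ _ ≫ _ ◁ F.map (T.μIso Y Z).hom =
      G.obj X ◁ μ G Y Z ≫ ((T.iso X).hom ⊗ₘ (T.iso (Y ⊗ Z)).hom) := by
    simp only [← id_tensorHom, tensorHom_comp_tensorHom, Category.comp_id, Category.id_comp,
      iso_tensor_comp_μ_comp_map_μIso]
  apply F.map_injective
  rw [← cancel_epi (μ F _ _), ← cancel_epi (μ F _ _ ▷ _),
    ← cancel_epi (((T.iso X).hom ⊗ₘ (T.iso Y).hom) ⊗ₘ (T.iso Z).hom)]
  simp only [F.map_comp]
  rw [← μ_natural_left_assoc, reassoc_of% left,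
    reassoc_of% (T.iso_tensor_comp_μ_comp_map_μIso (X ⊗ Y) Z), ← T.naturality,
    associativity_assoc, associativity_assoc, ← μ_natural_right_assoc,
    associator_naturality_assoc, reassoc_of% right, iso_tensor_comp_μ_comp_map_μIso]

theorem εIso_left_unitality (X : P) :
    (λ_ (T.functor.obj X)).hom =
      T.εIso.hom ▷ _ ≫ (T.μIso (𝟙_ P) X).hom ≫ T.functor.map (λ_ X).hom := by
  have unit : 𝟙_ C ◁ (T.iso X).hom ≫ ε F ▷ _ ≫ F.map T.εIso.hom ▷ _ =
      ε G ▷ G.obj X ≫ ((T.iso (𝟙_ P)).hom ⊗ₘ (T.iso X).hom) := by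
    simp only [← tensorHom_id, ← id_tensorHom, tensorHom_comp_tensorHom, Category.comp_id,
      Category.id_comp, ε_comp_map_εIso]
  apply F.map_injective
  rw [← cancel_epi (μ F _ _), ← cancel_epi (ε F ▷ _), ← cancel_epi (𝟙_ C ◁ (T.iso X).hom),
    ← left_unitality, leftUnitor_naturality, left_unitality G, Category.assoc, Category.assoc,
    T.naturality, F.map_comp, F.map_comp, ← μ_natural_left_assoc, reassoc_of% unit,
    reassoc_of% (T.iso_tensor_comp_μ_comp_map_μIso (𝟙_ P) X)]

theorem εIso_right_unitality (X : P) :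
    (ρ_ (T.functor.obj X)).hom =
      _ ◁ T.εIso.hom ≫ (T.μIso X (𝟙_ P)).hom ≫ T.functor.map (ρ_ X).hom := by
  have unit : (T.iso X).hom ▷ 𝟙_ C ≫ _ ◁ ε F ≫ _ ◁ F.map T.εIso.hom =
      G.obj X ◁ ε G ≫ ((T.iso X).hom ⊗ₘ (T.iso (𝟙_ P)).hom) := by
    simp only [← tensorHom_id, ← id_tensorHom, tensorHom_comp_tensorHom, Category.comp_id,
      Category.id_comp, ε_comp_map_εIso]
  apply F.map_injective
  rw [← cancel_epi (μ F _ _), ← cancel_epi (_ ◁ ε F), ← cancel_epi ((T.iso X).hom ▷ 𝟙_ C),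
    ← right_unitality, rightUnitor_naturality, right_unitality G, Category.assoc, Category.assoc,
    T.naturality, F.map_comp, F.map_comp, ← μ_natural_right_assoc, reassoc_of% unit,
    reassoc_of% (T.iso_tensor_comp_μ_comp_map_μIso X (𝟙_ P))]

/-- A lift of a monoidal functor along a fully faithful monoidal functor is monoidal. -/
instance monoidal : T.functor.Monoidal :=
  Functor.CoreMonoidal.toMonoidal
    { εIso := T.εIso
      μIso := T.μIso
      μIso_hom_natural_left := fun f Z => by simpa using T.μIso_natural f (𝟙 Z)
      μIso_hom_natural_right := fun Z f => by simpa using T.μIso_natural (𝟙 Z) f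
      associativity := T.μIso_associativity
      left_unitality := T.εIso_left_unitality
      right_unitality := T.εIso_right_unitality }

theorem iso_tensor_comp_μ (X Y : P) :
    ((T.iso X).hom ⊗ₘ (T.iso Y).hom) ≫ μ F _ _ ≫ F.map (μ T.functor X Y) =
      μ G X Y ≫ (T.iso (X ⊗ Y)).hom :=
  T.iso_tensor_comp_μ_comp_map_μIso X Y

instance natIso_hom_isMonoidal : NatTrans.IsMonoidal T.natIso.hom where
  unit := T.ε_comp_map_εIso.symm
  tensor X Y := (T.iso_tensor_comp_μ X Y).symm

end Monoidal

instance braided [BraidedCategory P] [BraidedCategory C] [BraidedCategory D] [G.Braided]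
    [F.Braided] (T : FunctorLift G F) : T.functor.Braided where
  braided X Y := by
    apply F.map_injective
    rw [← cancel_epi (μ F _ _), ← cancel_epi ((T.iso X).hom ⊗ₘ (T.iso Y).hom),
      F.map_comp, F.map_comp, reassoc_of% (T.iso_tensor_comp_μ X Y), ← T.naturality,
      Functor.LaxBraided.braided_assoc, Functor.LaxBraided.braided_assoc,
      BraidedCategory.braiding_naturality_assoc, iso_tensor_comp_μ]

end FunctorLift

end FunctorLift

theorem eqToHom_tensorHom_eqToHom {C : Type u} [Category.{v} C] [MonoidalCategory C]
    {a b c d : C} (h : a = b) (k : c = d) :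
    (eqToHom h ⊗ₘ eqToHom k) = eqToHom (congrArg₂ (· ⊗ ·) h k) := by
  subst h k
  simp

section StrictPowers

variable {D : Type u} [Category.{v} D] [MonoidalCategory D] [StrictMonoidal D]

theorem tpow_succ_eq (d : D) (n : ℕ) : tpow d (n + 1) = tpow d n ⊗ d := by
  cases n with
  | zero => exact (StrictMonoidal.unit_tensor d).symm
  | succ n => rfl

theorem tpow_add_eq (d : D) (m n : ℕ) : tpow d m ⊗ tpow d n = tpow d (m + n) := by
  induction n with
  | zero => exact StrictMonoidal.tensor_unit _
  | succ n ih =>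
    rw [tpow_succ_eq d n, ← StrictMonoidal.assoc, ih]
    exact (tpow_succ_eq d (m + n)).symm

theorem inv_eq_eqToHom {C : Type u} [Category.{v} C] {X Y : C} {e : X ≅ Y} {h : X = Y}
    (he : e.hom = eqToHom h) : e.inv = eqToHom h.symm := by
  rw [← cancel_epi e.hom, Iso.hom_inv_id, he, eqToHom_trans, eqToHom_refl]

theorem tpowSucc_hom_eq (d : D) (n : ℕ) :
    (tpowSucc d n).hom = eqToHom (tpow_succ_eq d n) := by
  cases n with
  | zero => exact inv_eq_eqToHom (StrictMonoidal.leftUnitor_eq d)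
  | succ n => rfl

theorem tpowAdd_hom_eq (d : D) (m n : ℕ) :
    (tpowAdd d m n).hom = eqToHom (tpow_add_eq d m n) := by
  induction n with
  | zero => exact StrictMonoidal.rightUnitor_eq _
  | succ n ih =>
    rw [tpowAdd_succ_hom, ih, tpowSucc_hom_eq, inv_eq_eqToHom (tpowSucc_hom_eq d (m + n)),
      inv_eq_eqToHom (StrictMonoidal.associator_eq _ _ _)]
    simp only [whiskerLeft_eqToHom, eqToHom_whiskerRight, eqToHom_trans]

end StrictPowers

theorem eq_eqToHom_of_unitality {C : Type u} [Category.{v} C]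
    [MonoidalCategory C] {Y : C} (e : 𝟙_ C ⟶ Y) (h : 𝟙_ C = Y)
    (he : (λ_ Y).hom =
      e ▷ Y ≫ (eqToHom h.symm ⊗ₘ eqToHom h.symm) ≫ (ρ_ (𝟙_ C)).hom ≫ eqToHom h) :
    e = eqToHom h := by
  subst h
  simp only [eqToHom_refl, id_tensorHom_id, Category.id_comp, Category.comp_id,
    rightUnitor_naturality, unitors_equal] at he
  rw [← cancel_epi (ρ_ (𝟙_ C)).hom, ← he, eqToHom_refl, Category.comp_id]

namespace Supply

open PropCat

section StructureMorphisms

variable {P : Type u₁} [Category.{v₁} P] [MonoidalCategory P] [SymmetricCategory P] [PropCat P]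
  {C : Type u} [Category.{v} C] [MonoidalCategory C] [SymmetricCategory C] (s : Supply P C)

theorem functor_obj_eq (c : C) {X : P} {m : ℕ} (hX : ob m = X) :
    (s.functor c).obj X = tpow c m := by
  rw [← hX, s.obj_eq]

theorem functor_obj_tensor_eq (c : C) {X Y : P} {m n : ℕ} (hX : ob m = X) (hY : ob n = Y) :
    (s.functor c).obj (X ⊗ Y) = tpow c (m + n) :=
  s.functor_obj_eq c ((ob_add m n).trans (congrArg₂ (· ⊗ ·) hX hY))

theorem μ_functor (c : C) {X Y : P} {m n : ℕ} (hX : ob m = X) (hY : ob n = Y) :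
    μ (s.functor c) X Y =
      (eqToHom (s.functor_obj_eq c hX) ⊗ₘ eqToHom (s.functor_obj_eq c hY)) ≫
        (tpowAdd c m n).hom ≫ eqToHom (s.functor_obj_tensor_eq c hX hY).symm := by
  subst hX hY
  rw [← s.mu_eq]
  simp [tensorHom_comp_tensorHom_assoc]

-- With `μ` known at the unit, left unitality determines `ε`.
theorem ε_functor (c : C) : ε (s.functor c) = eqToHom (s.functor_obj_eq c ob_zero).symm := by
  apply eq_eqToHom_of_unitality
  have h := left_unitality (s.functor c) (𝟙_ P)
  rw [s.μ_functor c ob_zero ob_zero, StrictMonoidal.leftUnitor_eq (𝟙_ P), eqToHom_map] at h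
  simp only [Category.assoc, eqToHom_trans] at h
  exact h

theorem isStrictFunctor [StrictMonoidal C] (c : C) : IsStrictFunctor (s.functor c) := by
  refine ⟨⟨_, s.ε_functor c⟩, fun X Y => ?_⟩
  rw [s.μ_functor c (ob_index X) (ob_index Y), tpowAdd_hom_eq, eqToHom_tensorHom_eqToHom,
    eqToHom_trans, eqToHom_trans]
  exact ⟨_, rfl⟩

end StructureMorphisms

end Supply

theorem SameMonoidalFunctor.of_eqToHom {P : Type u₁} [Category.{v₁} P] [MonoidalCategory P]
    {C : Type u} [Category.{v} C] [MonoidalCategory C] {F G : P ⥤ C} [F.Monoidal] [G.Monoidal]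
    (φ : F ⟶ G) [NatTrans.IsMonoidal φ] (hφ : ∀ X, ∃ h, φ.app X = eqToHom h) :
    SameMonoidalFunctor G F := by
  choose obj_eq φ_eq using hφ
  have tensor_eq (X Y : P) : F.obj X ⊗ F.obj Y = G.obj X ⊗ G.obj Y :=
    congrArg₂ (· ⊗ ·) (obj_eq X) (obj_eq Y)
  refine ⟨CategoryTheory.Functor.ext (fun X => (obj_eq X).symm) fun X Y f => ?_, ?_, fun X Y => ?_⟩
  · rw [← φ_eq Y, φ.naturality, φ_eq, eqToHom_trans_assoc, eqToHom_refl, Category.id_comp]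
  · rw [← NatTrans.IsMonoidal.unit (τ := φ), φ_eq]
    exact comp_eqToHom_heq _ _
  · have h := NatTrans.IsMonoidal.tensor (τ := φ) X Y
    rw [φ_eq, φ_eq, φ_eq, eqToHom_tensorHom_eqToHom] at h
    exact (eqToHom_comp_heq _ (tensor_eq X Y)).symm.trans
      ((heq_of_eq h.symm).trans (comp_eqToHom_heq _ _))

namespace Supply

open PropCat

section Pullback

variable {P : Type u₁} [Category.{v₁} P] [MonoidalCategory P] [SymmetricCategory P] [PropCat P]
  {C : Type u} [Category.{v} C] [MonoidalCategory C] [SymmetricCategory C] (s : Supply P C)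
  {D : Type u₂} [Category.{v₂} D] [MonoidalCategory D] [SymmetricCategory D]
  (F : D ⥤ C) [F.Full] [F.Faithful] [F.Braided]

/-- The lift of `s_{F d}` along `F` whose value at `m` is `d^m`. -/
def pullbackLift (d : D) : FunctorLift (s.functor (F.obj d)) F :=
  FunctorLift.ofIso (fun X => tpow d (index X)) fun X =>
    eqToIso (s.functor_obj_eq (F.obj d) (ob_index X)) ≪≫ tpowComparison F d (index X)

theorem pullbackLift_obj_eq (d : D) {X : P} {m : ℕ} (hX : ob m = X) :
    (s.pullbackLift F d).functor.obj X = tpow d m :=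
  congrArg (tpow d) (hX ▸ index_ob m)

theorem pullbackLift_iso_hom (d : D) {X : P} {m : ℕ} (hX : ob m = X) :
    ((s.pullbackLift F d).iso X).hom =
      eqToHom (s.functor_obj_eq (F.obj d) hX) ≫ (tpowComparison F d m).hom ≫
        F.map (eqToHom (s.pullbackLift_obj_eq F d hX).symm) := by
  obtain rfl : index X = m := hX ▸ index_ob m
  change _ = _ ≫ (tpowComparison F d (index X)).hom ≫ F.map (𝟙 (tpow d (index X)))
  rw [F.map_id, Category.comp_id]
  rfl

/-- The morphism `d^m ⟶ d^n` supplied by the pulled back supply. -/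
def pullbackApp (d : D) {m n : ℕ} (f : (ob m : P) ⟶ ob n) : tpow d m ⟶ tpow d n :=
  eqToHom (s.pullbackLift_obj_eq F d rfl).symm ≫ (s.pullbackLift F d).functor.map f ≫
    eqToHom (s.pullbackLift_obj_eq F d rfl)

theorem tpowComparison_comp_map_pullbackApp (d : D) {m n : ℕ} (f : (ob m : P) ⟶ ob n) :
    (tpowComparison F d m).hom ≫ F.map (s.pullbackApp F d f) =
      s.app (F.obj d) f ≫ (tpowComparison F d n).hom := by
  have h := (s.pullbackLift F d).naturality f
  rw [pullbackLift_iso_hom s F d rfl, pullbackLift_iso_hom s F d rfl] at h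
  simp only [pullbackApp, app, F.map_comp, Category.assoc,
    ← cancel_epi (eqToHom (s.obj_eq (F.obj d) m)), eqToHom_trans_assoc, eqToHom_refl,
    Category.id_comp]
  rw [← reassoc_of% h, ← F.map_comp, eqToHom_trans, eqToHom_refl, F.map_id, Category.comp_id]

theorem tpowComparison_tensor_comp_map_pullbackApp (c d : D) {m n m' n' : ℕ}
    (f : (ob m : P) ⟶ ob n) (g : (ob m' : P) ⟶ ob n') :
    ((tpowComparison F c m).hom ⊗ₘ (tpowComparison F d m').hom) ≫ μ F _ _ ≫
        F.map (s.pullbackApp F c f ⊗ₘ s.pullbackApp F d g) =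
      (s.app (F.obj c) f ⊗ₘ s.app (F.obj d) g) ≫
        ((tpowComparison F c n).hom ⊗ₘ (tpowComparison F d n').hom) ≫ μ F _ _ := by
  rw [← μ_natural, tensorHom_comp_tensorHom_assoc, tpowComparison_comp_map_pullbackApp,
    tpowComparison_comp_map_pullbackApp, tensorHom_comp_tensorHom_assoc]

theorem pullbackApp_symmTensor (hμ : ∀ c d : D, s.IsHomomorphic (μ F c d)) (c d : D) {m n : ℕ}
    (f : (ob m : P) ⟶ ob n) :
    (s.pullbackApp F c f ⊗ₘ s.pullbackApp F d f) ≫ (symmTensor c d n).hom =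
      (symmTensor c d m).hom ≫ s.pullbackApp F (c ⊗ d) f := by
  apply F.map_injective
  rw [← cancel_epi (μ F (tpow c m) (tpow d m)),
    ← cancel_epi ((tpowComparison F c m).hom ⊗ₘ (tpowComparison F d m).hom), F.map_comp, F.map_comp,
    reassoc_of% (s.tpowComparison_tensor_comp_map_pullbackApp F c d f f),
    tpowComparison_symmTensor, reassoc_of% (tpowComparison_symmTensor F c d m),
    tpowComparison_comp_map_pullbackApp, reassoc_of% (hμ c d f),
    reassoc_of% (s.app_symmTensor _ _ f)]

theorem pullbackApp_symmUnit (hε : s.IsHomomorphic (ε F)) {m n : ℕ} (f : (ob m : P) ⟶ ob n) :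
    (symmUnit D n).hom = (symmUnit D m).hom ≫ s.pullbackApp F (𝟙_ D) f := by
  apply F.map_injective
  rw [← cancel_epi (ε F), F.map_comp, reassoc_of% (ε_comp_map_symmUnit F m),
    ε_comp_map_symmUnit, tpowComparison_comp_map_pullbackApp, reassoc_of% (hε f),
    reassoc_of% (s.app_symmUnit f)]

theorem μ_pullbackLift (d : D) (m n : ℕ) :
    (eqToHom (s.pullbackLift_obj_eq F d rfl).symm ⊗ₘ
          eqToHom (s.pullbackLift_obj_eq F d rfl).symm) ≫
        μ (s.pullbackLift F d).functor (ob m) (ob n) ≫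
        eqToHom (s.pullbackLift_obj_eq F d (ob_add m n)) =
      (tpowAdd d m n).hom := by
  have h := (s.pullbackLift F d).iso_tensor_comp_μ (ob m) (ob n)
  rw [s.μ_functor (F.obj d) rfl rfl, pullbackLift_iso_hom s F d rfl, pullbackLift_iso_hom s F d rfl,
    pullbackLift_iso_hom s F d (ob_add m n), ← tensorHom_comp_tensorHom_assoc,
    Category.assoc, cancel_epi, ← tensorHom_comp_tensorHom_assoc, μ_natural_assoc, Category.assoc,
    eqToHom_trans_assoc, eqToHom_refl, Category.id_comp,
    ← reassoc_of% (tpowComparison_tpowAdd F d m n), cancel_epi, cancel_epi] at h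
  apply F.map_injective
  rw [F.map_comp, F.map_comp, reassoc_of% h, ← F.map_comp, eqToHom_trans, eqToHom_refl, F.map_id,
    Category.comp_id]

/-- The supply pulled back along a fully faithful symmetric monoidal functor whose structure
morphisms are homomorphic. -/
def pullback (hε : s.IsHomomorphic (ε F)) (hμ : ∀ c d : D, s.IsHomomorphic (μ F c d)) :
    Supply P D where
  functor d := (s.pullbackLift F d).functor
  obj_eq d _ := s.pullbackLift_obj_eq F d rfl
  mu_eq := s.μ_pullbackLift F
  tensor_comm c d _ _ f := s.pullbackApp_symmTensor F hμ c d f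
  unit_comm _ _ f := s.pullbackApp_symmUnit F hε f

theorem pullback_comp_sameMonoidalFunctor (hε : s.IsHomomorphic (ε F))
    (hμ : ∀ c d : D, s.IsHomomorphic (μ F c d)) (d : D)
    (comparison_eq : ∀ n, ∃ h, (tpowComparison F d n).hom = eqToHom h) :
    SameMonoidalFunctor ((s.pullback F hε hμ).functor d ⋙ F) (s.functor (F.obj d)) := by
  change SameMonoidalFunctor ((s.pullbackLift F d).functor ⋙ F) _
  refine SameMonoidalFunctor.of_eqToHom (s.pullbackLift F d).natIso.hom fun X => ?_
  obtain ⟨h, hom_eq⟩ := comparison_eq (index X)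
  have obj_eq := s.functor_obj_eq (F.obj d) (ob_index X)
  exact ⟨obj_eq.trans h, (congrArg (eqToHom obj_eq ≫ ·) hom_eq).trans (eqToHom_trans _ _)⟩

end Pullback

section Blocks

variable {P : Type u₁} [Category.{v₁} P] [MonoidalCategory P] [SymmetricCategory P] [PropCat P]
  {C : Type u} [Category.{v} C] [MonoidalCategory C] [SymmetricCategory C]

theorem app_eq_blocks (t : Supply P (Strictification C)) (L : List C) {m n : ℕ}
    (f : (ob m : P) ⟶ ob n) :
    t.app (ofList L) f =
      (blocksSymm m L).inv ≫ blocksMap (fun c => t.app (ofList [c]) f) L ≫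
        (blocksSymm n L).hom := by
  rw [Iso.eq_inv_comp]
  induction L with
  | nil => exact (t.app_symmUnit f).trans (Category.id_comp _).symm
  | cons c l ih =>
    change (tpow (ofList [c]) m ◁ (blocksSymm m l).hom ≫
        (symmTensor (ofList [c]) (ofList l) m).hom) ≫ t.app (ofList [c] ⊗ ofList l) f =
      (t.app (ofList [c]) f ⊗ₘ blocksMap (fun c => t.app (ofList [c]) f) l) ≫
        tpow (ofList [c]) n ◁ (blocksSymm n l).hom ≫
          (symmTensor (ofList [c]) (ofList l) n).hom
    rw [Category.assoc, app_symmTensor, ← id_tensorHom, ← id_tensorHom,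
      tensorHom_comp_tensorHom_assoc, tensorHom_comp_tensorHom_assoc, ih, Category.comp_id,
      Category.id_comp]

end Blocks

end Supply

section Singletons

variable {C : Type u} [Category.{v} C] [MonoidalCategory C]

theorem tensorFrom_append_singleton (X c : C) (l : List C) :
    tensorFrom X (l ++ [c]) = tensorFrom X l ⊗ c := by
  induction l generalizing X with
  | nil => rfl
  | cons d _ ih => exact ih (X ⊗ d)

theorem tensorFromAppend_singleton (X c : C) (l : List C) :
    (tensorFromAppend [c] X l).hom = eqToHom (tensorFrom_append_singleton X c l).symm := by
  induction l generalizing X with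
  | nil => rfl
  | cons d _ ih => exact ih (X ⊗ d)

theorem bigTensorAppend_singleton (c : C) {L : List C} (hL : L ≠ []) :
    ∃ h : bigTensor L ⊗ c = bigTensor (L ++ [c]), (bigTensorAppend L [c]).hom = eqToHom h := by
  cases L with
  | nil => exact absurd rfl hL
  | cons d l =>
    exact ⟨(tensorFrom_append_singleton d c l).symm, tensorFromAppend_singleton d c l⟩

theorem tpow_singleton_ne_nil (c : C) (n : ℕ) :
    @Ne (List C) (tpow (C := Strictification C) (ofList [c]) (n + 1)) [] := by
  cases n with
  | zero => exact List.cons_ne_nil c []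
  | succ n => exact List.append_ne_nil_of_right_ne_nil _ (List.cons_ne_nil c [])

theorem tpowComparison_singleton (c : C) (n : ℕ) :
    ∃ h : tpow c n = (tensorFunctor C).obj (tpow (ofList [c]) n),
      (tpowComparison (tensorFunctor C) (ofList [c]) n).hom = eqToHom h := by
  induction n with
  | zero => exact ⟨rfl, rfl⟩
  | succ n ih =>
    cases n with
    | zero =>
      refine ⟨rfl, ?_⟩
      change (λ_ c).inv ≫ (𝟙 (𝟙_ C) ⊗ₘ 𝟙 c) ≫ (λ_ c).hom ≫ 𝟙 c = 𝟙 c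
      simp
    | succ n =>
      obtain ⟨h, e⟩ := ih
      obtain ⟨h', e'⟩ := bigTensorAppend_singleton c (tpow_singleton_ne_nil c n)
      refine ⟨(congrArg (· ⊗ c) h).trans h', ?_⟩
      change 𝟙 _ ≫ ((tpowComparison (tensorFunctor C) (ofList [c]) (n + 1)).hom ⊗ₘ 𝟙 c) ≫
        (bigTensorAppend (tpow (C := Strictification C) (ofList [c]) (n + 1)) [c]).hom ≫ 𝟙 _ = _
      rw [e, e', tensorHom_id, eqToHom_whiskerRight, Category.comp_id, Category.id_comp,
        eqToHom_trans]

end Singletons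

section Main

variable {P : Type u₁} [Category.{v₁} P] [MonoidalCategory P] [SymmetricCategory P] [PropCat P]
  {C : Type u} [Category.{v} C] [MonoidalCategory C] [SymmetricCategory C] (s : Supply P C)

/-- The supply induced on the strictification. -/
def Supply.strictification : Supply P (Strictification C) :=
  s.pullback (tensorFunctor C) (s.isHomomorphic_id (𝟙_ C)) s.isHomomorphic_bigTensorAppend

theorem Supply.strictification_singleton (c : C) :
    SameMonoidalFunctor
      (s.strictification.functor (ofList [c]) ⋙ tensorFunctor C) (s.functor c) :=
  s.pullback_comp_sameMonoidalFunctor (tensorFunctor C) _ _ (ofList [c])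
    (tpowComparison_singleton c)

end Main

end Supplies

end

theorem mainTheorem3 {P : Type*} [Category P] [MonoidalCategory P] [SymmetricCategory P]
    [Supplies.PropCat P] {C : Type*} [Category C] [MonoidalCategory C] [SymmetricCategory C]
    (s : Supplies.Supply P C) :
    ∃ t : Supplies.Supply P (Supplies.Strictification C),
      (∀ L : List C, Supplies.IsStrictFunctor (t.functor (Supplies.ofList L))) ∧
      (∀ c : C, Supplies.SameMonoidalFunctor
        (t.functor (Supplies.ofList [c]) ⋙ Supplies.tensorFunctor C) (s.functor c)) ∧
      (∀ (L : List C) (m n : ℕ) (f : (Supplies.PropCat.ob m : P) ⟶ Supplies.PropCat.ob n),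
        t.app (Supplies.ofList L) f =
          (Supplies.blocksSymm m L).inv ≫
            Supplies.blocksMap (fun c => t.app (Supplies.ofList [c]) f) L ≫
              (Supplies.blocksSymm n L).hom) := by
  exact ⟨s.strictification, fun L => s.strictification.isStrictFunctor (Supplies.ofList L),
    s.strictification_singleton, fun L _ _ f => s.strictification.app_eq_blocks L f⟩
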